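/- Let $x,y,h$ be the standard basis of $\mathfrak{sl}_2=\mathfrak{sl}_2(\mathbb C)$, and let $\mathfrak{sl}_2[t]=\mathfrak{sl}_2\otimes\mathbb C[t]$ be the current algebra with bracket $[a\otimes t^r,b\otimes t^s]=[a,b]\otimes t^{r+s}$. Let $W(1)$ be the global Weyl module, i.e. the $\mathfrak{sl}_2[t]$-module generated by an element $w_1$ with relations $(x\otimes\mathbb C[t])w_1=0$, $(h\otimes 1)w_1=w_1$, $(y\otimes 1)^2w_1=0$, graded so that $w_1$ has grade $0$ and $a\otimes t^r$ has degree $r$. Let $V(1)$ be the natural representation of $\mathfrak{sl}_2$ with basis $e_1,e_2$, where $xe_1=0$, $he_1=e_1$, $ye_1=e_2$. The $\mathfrak{sl}_2[t]$-module $W(1)$ is identified with $V(1)\otimes\mathbb C[t]$, where $(a\otimes t^r)(v\otimes t^s)=av\otimes t^{r+s}$, by the isomorphism taking $w_1$ to $e_1\otimes 1$; correspondingly $W(1)^{\otimes\lambda}$ is identified with $V(1)^{\otimes\lambda}\otimes\mathbb C[t_1,\dots,t_\lambda]$. For an integer $\lambda\ge 0$, let $\wedge^\lambda W(1)\subset W(1)^{\otimes\lambda}$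 be the isotypical component of the sign representation of the symmetric group $S_\lambda$, with the induced grading. For a module $M$ and $\mu\in\mathbb Z$ put $M_\mu=\{m\in M:(h\otimes 1)m=\mu m\}$. Let $\mathrm{Vand}(\lambda)$ be the Vandermonde determinant in $t_1,\dots,t_\lambda$ (equal to $1$ for $\lambda\le 1$). **Proposition 4.2.** Let $\lambda\ge 0$ be an integer. (i) If $M$ is a nonzero graded $\mathfrak{sl}_2[t]$-submodule of $\wedge^\lambda W(1)$, then $M_\lambda\neq 0$. (ii) The subspace $(\wedge^\lambda W(1))_\lambda$ is generated as an $(h\otimes\mathbb C[t])$-module by the element $e_1^{\otimes\lambda}\otimes\mathrm{Vand}(\lambda)$. (iii) The module $\wedge^\lambda W(1)$ is an indecomposable $\mathfrak{sl}_2[t]$-module: it is nonzero and is not the direct sum of two nonzero $\mathfrak{sl}_2[t]$-submodules. -/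

import Mathlib

open scoped TensorProduct Polynomial

noncomputable section

namespace CurrentSl2

attribute [local instance 100] LieRing.ofAssociativeRing

/-! ### The current algebra `sl₂[t]` -/

/-- The Lie algebra of trace zero `2 × 2` complex matrices. -/
abbrev Sl2 : Type := LieAlgebra.SpecialLinear.sl (Fin 2) ℂ

/-- The element `x` of the standard basis. -/
def slx : Sl2 := ⟨!![0, 1; 0, 0], by
  simp [LieAlgebra.SpecialLinear.sl, Matrix.trace_fin_two]⟩

/-- The element `y` of the standard basis. -/
def sly : Sl2 := ⟨!![0, 0; 1, 0], by
  simp [LieAlgebra.SpecialLinear.sl, Matrix.trace_fin_two]⟩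

/-- The element `h` of the standard basis. -/
def slh : Sl2 := ⟨!![1, 0; 0, -1], by
  simp [LieAlgebra.SpecialLinear.sl, Matrix.trace_fin_two]⟩

/-- The current algebra `sl₂ ⊗ ℂ[t]`, with bracket `[p ⊗ a, q ⊗ b] = p q ⊗ [a, b]`
(the polynomial factor is written on the left). -/
abbrev Current : Type := ℂ[X] ⊗[ℂ] Sl2

/-- The commutative Lie subalgebra `h ⊗ ℂ[t]`. -/
def currentCartan : LieSubalgebra ℂ Current where
  __ := LinearMap.range ((TensorProduct.mk ℂ ℂ[X] Sl2).flip slh)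
  lie_mem' := by
    rintro _ _ ⟨p, rfl⟩ ⟨q, rfl⟩
    exact ⟨0, by simp [LieAlgebra.ExtendScalars.bracket_tmul]⟩

/-- The `μ`-weight space `{m : h m = μ m}` of a representation of `sl₂[t]`. -/
def weightSpace (M : Type*) [AddCommGroup M] [Module ℂ M] [LieRingModule Current M]
    [LieModule ℂ Current M] (μ : ℤ) : Submodule ℂ M :=
  Module.End.eigenspace (LieModule.toEnd ℂ Current M ((1 : ℂ[X]) ⊗ₜ[ℂ] slh)) (μ : ℂ)

/-- A representation is indecomposable if it is nonzero and is not the direct sum of two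
nonzero subrepresentations. -/
def Indecomposable (M : Type*) [AddCommGroup M] [Module ℂ M] [LieRingModule Current M]
    [LieModule ℂ Current M] : Prop :=
  Nontrivial M ∧ ∀ U V : LieSubmodule ℂ Current M,
    IsCompl U.toSubmodule V.toSubmodule → U = ⊥ ∨ V = ⊥

/-- Given a grading `gr` of a representation, a subrepresentation `N` is graded if it is the sum
of its intersections with the graded pieces. -/
def IsGradedSub {M : Type*} [AddCommGroup M] [Module ℂ M] [LieRingModule Current M]
    [LieModule ℂ Current M] (gr : ℤ → Submodule ℂ M) (N : LieSubmodule ℂ Current M) : Prop :=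
  N.toSubmodule = ⨆ r : ℤ, N.toSubmodule ⊓ gr r

/-! ### The representations `V(1)` and `V(1) ⊗ ℂ[t]` -/

/-- The natural two-dimensional representation `V(1)` of `sl₂`. -/
def NatRep : Type := Fin 2 → ℂ

instance : AddCommGroup NatRep := inferInstanceAs (AddCommGroup (Fin 2 → ℂ))
instance : Module ℂ NatRep := inferInstanceAs (Module ℂ (Fin 2 → ℂ))

/-- A matrix of trace zero acts on column vectors by multiplication. -/
instance : LieRingModule Sl2 NatRep where
  bracket a v := Matrix.mulVec a.val v
  add_lie a b v := Matrix.add_mulVec a.val b.val v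
  lie_add a v w := Matrix.mulVec_add a.val v w
  leibniz_lie a b v := by
    have h : ∀ u : Fin 2 → ℂ, a.val.mulVec (b.val.mulVec u) =
        Matrix.mulVec (a.val * b.val - b.val * a.val) u + b.val.mulVec (a.val.mulVec u) := by
      intro u
      rw [Matrix.sub_mulVec, Matrix.mulVec_mulVec, Matrix.mulVec_mulVec, sub_add_cancel]
    exact h v

instance : LieModule ℂ Sl2 NatRep where
  smul_lie c a v := Matrix.smul_mulVec c a.val v
  lie_smul c a v := Matrix.mulVec_smul a.val c v

/-- The basis vector `e₁` of `V(1)`. -/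
def e1 : NatRep := (![1, 0] : Fin 2 → ℂ)

/-- The space `V(1) ⊗ ℂ[t]`, on which `sl₂[t]` acts by `(p ⊗ a)(q ⊗ v) = p q ⊗ a v`. -/
abbrev NatRepT : Type := ℂ[X] ⊗[ℂ] NatRep

instance : LieModule ℂ Current NatRepT where
  smul_lie c a v := by
    have h1 : c • a = (Polynomial.C c : ℂ[X]) • a :=
      (algebraMap_smul ℂ[X] c a).symm
    have h2 : c • ⁅a, v⁆ = (Polynomial.C c : ℂ[X]) • ⁅a, v⁆ :=
      (algebraMap_smul ℂ[X] c ⁅a, v⁆).symm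
    rw [h1, h2]
    exact LieModule.smul_lie (R := ℂ[X]) (Polynomial.C c) a v
  lie_smul c a v := by
    have h1 : c • v = (Polynomial.C c : ℂ[X]) • v :=
      (algebraMap_smul ℂ[X] c v).symm
    have h2 : c • ⁅a, v⁆ = (Polynomial.C c : ℂ[X]) • ⁅a, v⁆ :=
      (algebraMap_smul ℂ[X] c ⁅a, v⁆).symm
    rw [h1, h2]
    exact LieModule.lie_smul (R := ℂ[X]) (Polynomial.C c) a v

/-! ### Global Weyl modules -/

/-- The enveloping algebra of `sl₂[t]`. -/
abbrev Env : Type := UniversalEnvelopingAlgebra ℂ Current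

/-- The canonical map of `sl₂[t]` into its enveloping algebra. -/
abbrev envι : Current →ₗ⁅ℂ⁆ Env := UniversalEnvelopingAlgebra.ι ℂ

/-- The left ideal of the enveloping algebra generated by the defining relations of `W(l)`:
`x ⊗ p` for all polynomials `p`, `h ⊗ 1 - l`, and `(y ⊗ 1) ^ (l + 1)`. -/
def weylIdeal (l : ℕ) : Submodule Env Env :=
  Submodule.span Env
    (Set.range (fun p : ℂ[X] => envι (p ⊗ₜ[ℂ] slx)) ∪
      {envι ((1 : ℂ[X]) ⊗ₜ[ℂ] slh) - algebraMap ℂ Env (l : ℂ),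
        envι ((1 : ℂ[X]) ⊗ₜ[ℂ] sly) ^ (l + 1)})

/-- The global Weyl module `W(l)`, i.e. the cyclic `sl₂[t]`-module with generator `w` and relations
`(x ⊗ ℂ[t]) w = 0`, `(h ⊗ 1) w = l w`, `(y ⊗ 1) ^ (l + 1) w = 0`. -/
def Weyl (l : ℕ) : Type := Env ⧸ weylIdeal l

instance (l : ℕ) : AddCommGroup (Weyl l) := inferInstanceAs (AddCommGroup (Env ⧸ weylIdeal l))
instance (l : ℕ) : Module Env (Weyl l) := inferInstanceAs (Module Env (Env ⧸ weylIdeal l))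
instance (l : ℕ) : Module ℂ (Weyl l) := inferInstanceAs (Module ℂ (Env ⧸ weylIdeal l))
instance (l : ℕ) : IsScalarTower ℂ Env (Weyl l) :=
  inferInstanceAs (IsScalarTower ℂ Env (Env ⧸ weylIdeal l))

instance (l : ℕ) : LieRingModule Current (Weyl l) where
  bracket a m := envι a • m
  add_lie a b m := by
    change envι (a + b) • m = envι a • m + envι b • m
    rw [map_add, add_smul]
  lie_add a m n := smul_add _ m n
  leibniz_lie a b m := by
    change envι a • envι b • m = envι ⁅a, b⁆ • m + envι b • envι a • m
    rw [LieHom.map_lie, LieRing.of_associative_ring_bracket, sub_smul, mul_smul, mul_smul,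
      sub_add_cancel]

instance (l : ℕ) : LieModule ℂ Current (Weyl l) where
  smul_lie c a m := by
    change envι (c • a) • m = c • envι a • m
    rw [map_smul, smul_assoc]
  lie_smul c a m := by
    change envι a • c • m = c • envι a • m
    rw [← algebraMap_smul Env c m, ← algebraMap_smul Env c (envι a • m), smul_smul, smul_smul,
      Algebra.commutes]

/-- The generator `w` of `W(l)`. -/
def weylGen (l : ℕ) : Weyl l := Submodule.Quotient.mk (p := weylIdeal l) (1 : Env)

/-- The piece of grade `r` of the enveloping algebra: the span of the monomials
`(a₁ ⊗ t ^ r₁) ⋯ (aₛ ⊗ t ^ rₛ)` with `r₁ + ⋯ + rₛ = r`. -/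
def envGrade (r : ℤ) : Submodule ℂ Env :=
  Submodule.span ℂ {u : Env | ∃ m : List (ℕ × Sl2), ((m.map Prod.fst).sum : ℤ) = r ∧
    u = (m.map fun p => envι ((Polynomial.X ^ p.1 : ℂ[X]) ⊗ₜ[ℂ] p.2)).prod}

/-- The grading of `W(l)` for which the generator has grade `0`. -/
def weylGrade (l : ℕ) (r : ℤ) : Submodule ℂ (Weyl l) :=
  (envGrade r).map ((LinearMap.toSpanSingleton Env (Weyl l) (weylGen l)).restrictScalars ℂ)

/-! ### Tensor powers and exterior powers -/

section Tensor

variable (n : ℕ) (M : Type*) [AddCommGroup M] [Module ℂ M]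

/-- The `n`-th tensor power of `M`. -/
abbrev TPow : Type _ := PiTensorProduct ℂ (fun _ : Fin n => M)

variable {M}

/-- The operator `1 ⊗ ⋯ ⊗ f ⊗ ⋯ ⊗ 1` with `f` in position `i`. -/
def actAt (i : Fin n) (f : Module.End ℂ M) : Module.End ℂ (TPow n M) :=
  PiTensorProduct.map (Function.update (fun _ => (1 : Module.End ℂ M)) i f)

theorem actAt_lie (i j : Fin n) (f g : Module.End ℂ M) :
    ⁅actAt n i f, actAt n j g⁆ = if i = j then actAt n i ⁅f, g⁆ else 0 := by
  have key : ∀ (i j : Fin n) (f g : Module.End ℂ M), actAt n i f * actAt n j g =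
      PiTensorProduct.map (fun k => Function.update (fun _ => (1 : Module.End ℂ M)) i f k *
        Function.update (fun _ => (1 : Module.End ℂ M)) j g k) := by
    intro i j f g
    exact (PiTensorProduct.map_mul _ _).symm
  rw [LieRing.of_associative_ring_bracket]
  split_ifs with h
  · subst h
    have key2 : ∀ f g : Module.End ℂ M, actAt n i f * actAt n i g = actAt n i (f * g) := by
      intro f g
      rw [key, actAt]
      congr 1
      funext k
      by_cases hk : k = i
      · subst hk; simp
      · simp [hk]
    rw [key2, key2, LieRing.of_associative_ring_bracket, sub_eq_iff_eq_add]
    unfold actAt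
    rw [← PiTensorProduct.map_update_add, sub_add_cancel]
  · rw [key, key, sub_eq_zero]
    congr 1
    funext k
    by_cases hk : k = i
    · subst hk; simp [h]
    · simp [hk]

/-- The Lie algebra of endomorphisms of `M` acts on the tensor power by
`f (m₁ ⊗ ⋯ ⊗ mₙ) = ∑ i, m₁ ⊗ ⋯ ⊗ f mᵢ ⊗ ⋯ ⊗ mₙ`. -/
def tensorAct : Module.End ℂ M →ₗ⁅ℂ⁆ Module.End ℂ (TPow n M) where
  toFun f := ∑ i, actAt n i f
  map_add' f g := by
    simp only [actAt, PiTensorProduct.map_update_add, Finset.sum_add_distrib]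
  map_smul' c f := by
    simp only [actAt, PiTensorProduct.map_update_smul, Finset.smul_sum, RingHom.id_apply]
  map_lie' {f g} := by
    simp [sum_lie, lie_sum, actAt_lie]

theorem tensorAct_tprod (f : Module.End ℂ M) (v : Fin n → M) :
    tensorAct n f (PiTensorProduct.tprod ℂ v) =
      ∑ i, PiTensorProduct.tprod ℂ (Function.update v i (f (v i))) := by
  change (∑ i, actAt n i f) (PiTensorProduct.tprod ℂ v) = _
  rw [LinearMap.sum_apply]
  refine Finset.sum_congr rfl fun i _ => ?_
  rw [actAt, PiTensorProduct.map_tprod]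
  congr 1
  funext k
  by_cases hk : k = i
  · subst hk; simp
  · simp [hk]

/-- The action of a permutation on the tensor power. -/
def permAct (σ : Equiv.Perm (Fin n)) : TPow n M →ₗ[ℂ] TPow n M :=
  (PiTensorProduct.reindex ℂ (fun _ : Fin n => M) σ).toLinearMap

theorem permAct_tprod (σ : Equiv.Perm (Fin n)) (v : Fin n → M) :
    permAct n σ (PiTensorProduct.tprod ℂ v) = PiTensorProduct.tprod ℂ fun i => v (σ.symm i) :=
  PiTensorProduct.reindex_tprod σ v

variable [LieRingModule Current M] [LieModule ℂ Current M]

instance instTPowLieRingModule : LieRingModule Current (TPow n M) :=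
  LieRingModule.compLieHom (TPow n M) ((tensorAct n).comp (LieModule.toEnd ℂ Current M))

instance instTPowLieModule : LieModule ℂ Current (TPow n M) :=
  LieModule.compLieHom (TPow n M) ((tensorAct n).comp (LieModule.toEnd ℂ Current M))

theorem lie_tprod (a : Current) (v : Fin n → M) :
    ⁅a, (PiTensorProduct.tprod ℂ v : TPow n M)⁆ =
      ∑ i, PiTensorProduct.tprod ℂ (Function.update v i ⁅a, v i⁆) :=
  tensorAct_tprod n (LieModule.toEnd ℂ Current M a) v

theorem permAct_lie (σ : Equiv.Perm (Fin n)) (a : Current) (m : TPow n M) :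
    permAct n σ ⁅a, m⁆ = ⁅a, permAct n σ m⁆ := by
  have h : permAct n σ ∘ₗ LieModule.toEnd ℂ Current (TPow n M) a =
      LieModule.toEnd ℂ Current (TPow n M) a ∘ₗ permAct n σ := by
    refine PiTensorProduct.ext (MultilinearMap.ext fun v => ?_)
    change permAct n σ ⁅a, (PiTensorProduct.tprod ℂ v : TPow n M)⁆ =
      ⁅a, permAct n σ (PiTensorProduct.tprod ℂ v)⁆
    rw [lie_tprod, permAct_tprod, lie_tprod, map_sum, ← Equiv.sum_comp σ (fun i => PiTensorProduct.tprod ℂ (Function.update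
        (fun i => v (σ.symm i)) i ⁅a, v (σ.symm i)⁆))]
    refine Finset.sum_congr rfl fun i _ => ?_
    rw [permAct_tprod]
    congr 1
    funext k
    by_cases hk : k = σ i
    · subst hk; simp
    · have hk' : σ.symm k ≠ i := fun h => hk (by simp [← h])
      simp [hk, hk']
  exact LinearMap.congr_fun h m

variable (M)

/-- The exterior power of `M`, realized as the isotypical component of the sign representation
for the action of the symmetric group on the tensor power. -/
def wedge : LieSubmodule ℂ Current (TPow n M) where
  carrier := {m | ∀ σ : Equiv.Perm (Fin n), permAct n σ m = (((Equiv.Perm.sign σ : ℤˣ) : ℤ) : ℂ) • m}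
  add_mem' {a b} ha hb σ := by rw [map_add, ha σ, hb σ, smul_add]
  zero_mem' σ := by simp
  smul_mem' c m hm σ := by rw [map_smul, hm σ, smul_comm]
  lie_mem {a m} hm σ := by rw [permAct_lie, hm σ, lie_smul]

variable {M}

/-- The grading of the tensor power induced by a grading of `M`: the piece of grade `r` is the span
of the `m₁ ⊗ ⋯ ⊗ mₙ` with `mᵢ` of grade `sᵢ` and `s₁ + ⋯ + sₙ = r`. -/
def tensorGrade (gr : ℤ → Submodule ℂ M) (r : ℤ) : Submodule ℂ (TPow n M) :=
  Submodule.span ℂ {m | ∃ (s : Fin n → ℤ) (v : Fin n → M),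
    ∑ i, s i = r ∧ (∀ i, v i ∈ gr (s i)) ∧ m = PiTensorProduct.tprod ℂ v}

/-- The induced grading of the exterior power. -/
def wedgeGrade (gr : ℤ → Submodule ℂ M) (r : ℤ) : Submodule ℂ (wedge n M) :=
  (tensorGrade n gr r).comap (wedge n M).toSubmodule.subtype

end Tensor

/-! ### The element `e₁^{⊗ n} ⊗ Vand(n)` -/

/-- The polynomial `Vand(n)`: the Vandermonde determinant in `t₁, …, tₙ`. It is `1` for
`n = 0, 1`. -/
def vand (n : ℕ) : MvPolynomial (Fin n) ℂ :=
  (Matrix.vandermonde fun i : Fin n => (MvPolynomial.X i : MvPolynomial (Fin n) ℂ)).det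

/-- For a polynomial `f` in `t₁, …, tₙ`, the element `e₁^{⊗ n} ⊗ f` of
`V(1)^{⊗ n} ⊗ ℂ[t₁, …, tₙ] = (V(1) ⊗ ℂ[t])^{⊗ n}`: linear in `f`, and for `f = ∏ tᵢ ^ mᵢ` it is
`(e₁ ⊗ t ^ m₁) ⊗ ⋯ ⊗ (e₁ ⊗ t ^ mₙ)`. -/
def e1Tensor (n : ℕ) : MvPolynomial (Fin n) ℂ →ₗ[ℂ] TPow n NatRepT :=
  (MvPolynomial.basisMonomials (Fin n) ℂ).constr ℂ fun m =>
    PiTensorProduct.tprod ℂ fun i => (Polynomial.X ^ m i : ℂ[X]) ⊗ₜ[ℂ] e1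

end CurrentSl2

end

open CurrentSl2

/-! ### Symmetric and antisymmetric polynomials -/

namespace MvPolynomial

/-! Once `W(1)` is identified with `V(1) ⊗ ℂ[t]` (`weylEquiv`), a tensor is the family of its
components in `ℂ[t₁, …, tₙ]`, indexed by words `s` in `e₁, e₂` (`tensorCoord_injective`). The
`n`-weight space consists of the tensors whose only component is at `e₁^{⊗ n}`, that is `s = 0`
(`mem_weightSpace_iff`).

On such tensors `h ⊗ t ^ r` multiplies by the power sum of degree `r`. Power sums generate the
symmetric polynomials, so an `h ⊗ ℂ[t]`-stable subspace admits multiplication by all of them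
(`exists_mul_isSymmetric`). For a tensor in the sign component, the polynomial at `s = 0` is
antisymmetric, hence a symmetric multiple of the Vandermonde determinant (`exists_eq_vand_mul`).
This gives (ii).

For (i), apply operators `x ⊗ t ^ r` to a nonzero vector as long as some result is nonzero. Each
application turns one `e₂` into `e₁`, so this stops; a vector killed by all of them lies over `e₁^{⊗
n}` because a Vandermonde system has only the zero solution (`mem_highest_of_x_lie`,
`exists_mem_highest`).

For (iii), nonzero submodules contain nonzero vectors `Vand · f` and `Vand · g` with `f`, `g`
symmetric. Both then contain `Vand · f · g`, which is nonzero in a domain, so they cannot be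
complementary. -/

theorem esymm_mem_adjoin_psum (σ : Type*) [Fintype σ] (k : ℕ) :
    esymm σ ℂ k ∈ Algebra.adjoin ℂ (Set.range (psum σ ℂ)) := by
  classical
  induction k using Nat.strong_induction_on with
  | _ k ih =>
    rcases Nat.eq_zero_or_pos k with rfl | hk
    · rw [esymm_zero]
      exact one_mem _
    -- Newton's identity expresses `k · eₖ` through power sums and lower `eᵢ`; the factor `k` is
    -- then divided out.
    have h1 : (k : MvPolynomial σ ℂ) * esymm σ ℂ k ∈ Algebra.adjoin ℂ (Set.range (psum σ ℂ)) := by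
      rw [mul_esymm_eq_sum]
      refine mul_mem (pow_mem (neg_mem (one_mem _)) _) (sum_mem fun a ha => ?_)
      exact mul_mem (mul_mem (pow_mem (neg_mem (one_mem _)) _) (ih _ (Finset.mem_filter.1 ha).2))
        (Algebra.subset_adjoin ⟨_, rfl⟩)
    have h2 : esymm σ ℂ k = ((k : ℂ)⁻¹) • ((k : MvPolynomial σ ℂ) * esymm σ ℂ k) := by
      have hk' : (k : ℂ) ≠ 0 := by exact_mod_cast hk.ne'
      rw [← map_natCast (C : ℂ →+* MvPolynomial σ ℂ), ← smul_eq_C_mul, smul_smul,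
        inv_mul_cancel₀ hk', one_smul]
    rw [h2]
    exact Subalgebra.smul_mem _ h1 _

/-- In characteristic zero the power sums generate the symmetric polynomials. -/
theorem IsSymmetric.mem_adjoin_psum {n : ℕ} {f : MvPolynomial (Fin n) ℂ} (hf : f.IsSymmetric) :
    f ∈ Algebra.adjoin ℂ (Set.range (psum (Fin n) ℂ)) := by
  obtain ⟨q, hq⟩ := (esymmAlgHom_fin_bijective ℂ n).2 ⟨f, hf⟩
  have h := congrArg Subtype.val hq
  rw [esymmAlgHom_apply] at h
  change _ = f at h
  rw [← h]
  refine Algebra.adjoin_le ?_ (by rw [Algebra.adjoin_range_eq_range_aeval]; exact ⟨q, rfl⟩)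
  rintro _ ⟨i, rfl⟩
  exact esymm_mem_adjoin_psum _ _

section Substitution

variable {σ : Type*} [DecidableEq σ]

/-- The substitution `X i ↦ X j`. -/
noncomputable def identify (i j : σ) : MvPolynomial σ ℂ →ₐ[ℂ] MvPolynomial σ ℂ :=
  aeval fun k => if k = i then X j else X k

/-- The substitution becomes the identity modulo `X i - X j`, as is seen on the variables. -/
theorem X_sub_X_dvd_sub_identify (i j : σ) (f : MvPolynomial σ ℂ) :
    X i - X j ∣ f - identify i j f := by
  rw [← Ideal.mem_span_singleton, ← Ideal.Quotient.eq]
  have h : (Ideal.Quotient.mkₐ ℂ (Ideal.span {(X i - X j : MvPolynomial σ ℂ)})) =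
      (Ideal.Quotient.mkₐ ℂ (Ideal.span {(X i - X j : MvPolynomial σ ℂ)})).comp
        (identify i j) := by
    refine algHom_ext fun k => ?_
    simp only [AlgHom.comp_apply, identify, aeval_X]
    split_ifs with hk
    · subst hk
      exact Ideal.Quotient.eq.2 (Ideal.mem_span_singleton_self _)
    · rfl
  exact DFunLike.congr_fun h f

theorem X_sub_X_dvd_iff {i j : σ} {f : MvPolynomial σ ℂ} :
    X i - X j ∣ f ↔ identify i j f = 0 := by
  constructor
  · rintro ⟨g, rfl⟩
    simp [identify]
  · intro h
    simpa [h] using X_sub_X_dvd_sub_identify i j f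

/-- The multiples of `X i - X j` form the kernel of a homomorphism to a domain. -/
theorem prime_X_sub_X {i j : σ} (hij : i ≠ j) : Prime (X i - X j : MvPolynomial σ ℂ) := by
  refine ⟨sub_ne_zero.2 fun h => hij (X_injective h), fun h => ?_, fun a b h => ?_⟩
  · have := X_sub_X_dvd_iff.1 (isUnit_iff_dvd_one.1 h)
    simp at this
  · simp only [X_sub_X_dvd_iff, map_mul, mul_eq_zero] at h ⊢
    exact h

end Substitution

/-- Setting `tᵢ = tⱼ` makes `f` equal to its own negative, so every `tᵢ - tⱼ` divides `f`. These
factors are pairwise non-associated primes, so their product divides `f` too. -/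
theorem vandermonde_dvd_of_antisymmetric {n : ℕ} {f : MvPolynomial (Fin n) ℂ}
    (hf : ∀ i j : Fin n, i ≠ j → rename (Equiv.swap i j) f = -f) : CurrentSl2.vand n ∣ f := by
  have key : ∀ i j : Fin n, i ≠ j → X i - X j ∣ f := by
    intro i j hij
    rw [X_sub_X_dvd_iff]
    have h1 : (identify i j).comp (rename (Equiv.swap i j)) = identify i j := by
      refine algHom_ext fun k => ?_
      simp only [AlgHom.comp_apply, identify, aeval_X, rename_X]
      rcases eq_or_ne k i with rfl | hi
      · simp [hij.symm]
      · rcases eq_or_ne k j with rfl | hj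
        · simp [hi]
        · simp [Equiv.swap_apply_of_ne_of_ne hi hj, hi]
    have h2 := DFunLike.congr_fun h1 f
    rw [AlgHom.comp_apply, hf i j hij, map_neg] at h2
    exact self_eq_neg.1 h2.symm
  rw [CurrentSl2.vand, Matrix.det_vandermonde, Finset.prod_sigma']
  refine Finset.prod_dvd_of_isRelPrime ?_ ?_
  · rintro ⟨i, j⟩ hij ⟨a, b⟩ hab hne
    simp only [Finset.coe_sigma, Finset.coe_univ, Set.mem_sigma_iff, Set.mem_univ, true_and,
      Finset.coe_Ioi, Set.mem_Ioi] at hij hab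
    refine ((prime_X_sub_X hij.ne').irreducible.isRelPrime_iff_not_dvd).2 fun h => hne ?_
    rw [X_sub_X_dvd_iff] at h
    simp only [identify, map_sub, aeval_X, sub_eq_zero] at h
    -- Replacing `X j` by `X i` identifies `X a` and `X b` only when `{a, b} = {i, j}`; the
    -- orderings `i < j` and `a < b` then force equal pairs.
    split_ifs at h with h1 h2 h2
    · omega
    · have := X_injective h
      grind
    · have := X_injective h
      grind
    · have := X_injective h
      omega
  · rintro ⟨i, j⟩ hij
    exact key j i (by simpa using (Finset.mem_Ioi.1 (Finset.mem_sigma.1 hij).2).ne')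

/-- Permuting the variables permutes the rows of the Vandermonde matrix. -/
theorem rename_vand {n : ℕ} (σ : Equiv.Perm (Fin n)) :
    rename σ (CurrentSl2.vand n) = ((Equiv.Perm.sign σ : ℤˣ) : ℤ) * CurrentSl2.vand n := by
  have h : rename σ (CurrentSl2.vand n) =
      ((Matrix.vandermonde fun i : Fin n => (X i : MvPolynomial (Fin n) ℂ)).submatrix σ id).det := by
    rw [CurrentSl2.vand, ← AlgHom.coe_toRingHom, RingHom.map_det]
    congr 1
    ext i j
    simp [Matrix.vandermonde_apply]
  rw [h, Matrix.det_permute]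
  rfl

theorem vand_ne_zero (n : ℕ) : CurrentSl2.vand n ≠ 0 :=
  Matrix.det_vandermonde_ne_zero_iff.2 X_injective

/-- An antisymmetric polynomial is a symmetric multiple of the Vandermonde determinant. -/
theorem exists_isSymmetric_of_antisymmetric {n : ℕ} {f : MvPolynomial (Fin n) ℂ}
    (hf : ∀ σ : Equiv.Perm (Fin n), rename σ f = ((Equiv.Perm.sign σ : ℤˣ) : ℤ) * f) :
    ∃ g : MvPolynomial (Fin n) ℂ, g.IsSymmetric ∧ f = CurrentSl2.vand n * g := by
  obtain ⟨g, rfl⟩ := vandermonde_dvd_of_antisymmetric (f := f) fun i j hij => by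
    rw [hf, Equiv.Perm.sign_swap hij]; simp
  refine ⟨g, fun σ => ?_, rfl⟩
  have h := hf σ
  rw [map_mul, rename_vand, ← mul_assoc] at h
  refine mul_left_cancel₀ (mul_ne_zero ?_ (vand_ne_zero n)) h
  rcases Int.units_eq_one_or (Equiv.Perm.sign σ) with h | h <;> simp [h]

end MvPolynomial

noncomputable section

namespace CurrentSl2

attribute [local instance 100] LieRing.ofAssociativeRing

/-! ### Consequences of the defining relations of `W(1)` -/

theorem slh_lie_slx : ⁅slh, slx⁆ = (2 : ℂ) • slx := by
  ext i j
  fin_cases i <;> fin_cases j <;>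
    norm_num [slh, slx, LieRing.of_associative_ring_bracket, Matrix.mul_apply]

theorem slh_lie_sly : ⁅slh, sly⁆ = (-2 : ℂ) • sly := by
  ext i j
  fin_cases i <;> fin_cases j <;>
    norm_num [slh, sly, LieRing.of_associative_ring_bracket, Matrix.mul_apply]

theorem slx_lie_sly : ⁅slx, sly⁆ = slh := by
  ext i j
  fin_cases i <;> fin_cases j <;>
    norm_num [slh, slx, sly, LieRing.of_associative_ring_bracket, Matrix.mul_apply]

theorem sl2_eq (a : Sl2) : a = a.val 0 1 • slx + a.val 1 0 • sly + a.val 0 0 • slh := by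
  have ht : a.val 0 0 + a.val 1 1 = 0 := by
    have h : Matrix.trace a.val = 0 := a.2
    rwa [Matrix.trace_fin_two] at h
  ext i j
  fin_cases i <;> fin_cases j <;> simp [slh, slx, sly]
  linear_combination ht

section

variable {M : Type*} [AddCommGroup M] [LieRingModule Current M]

theorem current_add_lie (a b : Current) (m : M) : ⁅a + b, m⁆ = ⁅a, m⁆ + ⁅b, m⁆ := add_lie a b m

theorem current_zero_lie (m : M) : ⁅(0 : Current), m⁆ = 0 := zero_lie m

theorem lie_tmul_comm (p q : ℂ[X]) (a b : Sl2) (m : M) :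
    ⁅p ⊗ₜ[ℂ] a, ⁅q ⊗ₜ[ℂ] b, m⁆⁆ =
      ⁅(p * q) ⊗ₜ[ℂ] ⁅a, b⁆, m⁆ + ⁅q ⊗ₜ[ℂ] b, ⁅p ⊗ₜ[ℂ] a, m⁆⁆ := by
  rw [leibniz_lie, LieAlgebra.ExtendScalars.bracket_tmul]

theorem lie_x_y (p q : ℂ[X]) (m : M) : ⁅p ⊗ₜ[ℂ] slx, ⁅q ⊗ₜ[ℂ] sly, m⁆⁆ =
    ⁅(p * q) ⊗ₜ[ℂ] slh, m⁆ + ⁅q ⊗ₜ[ℂ] sly, ⁅p ⊗ₜ[ℂ] slx, m⁆⁆ := by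
  rw [lie_tmul_comm, slx_lie_sly]

end

variable {M : Type*} [AddCommGroup M] [Module ℂ M] [LieRingModule Current M]
  [LieModule ℂ Current M]

theorem current_smul_lie (c : ℂ) (a : Current) (m : M) : ⁅c • a, m⁆ = c • ⁅a, m⁆ := smul_lie c a m

theorem lie_h_y (p q : ℂ[X]) (m : M) : ⁅p ⊗ₜ[ℂ] slh, ⁅q ⊗ₜ[ℂ] sly, m⁆⁆ =
    (-2 : ℂ) • ⁅(p * q) ⊗ₜ[ℂ] sly, m⁆ + ⁅q ⊗ₜ[ℂ] sly, ⁅p ⊗ₜ[ℂ] slh, m⁆⁆ := by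
  rw [lie_tmul_comm, slh_lie_sly, TensorProduct.tmul_smul, current_smul_lie]

theorem lie_x_h (p q : ℂ[X]) (m : M) : ⁅p ⊗ₜ[ℂ] slx, ⁅q ⊗ₜ[ℂ] slh, m⁆⁆ =
    (-2 : ℂ) • ⁅(p * q) ⊗ₜ[ℂ] slx, m⁆ + ⁅q ⊗ₜ[ℂ] slh, ⁅p ⊗ₜ[ℂ] slx, m⁆⁆ := by
  rw [lie_tmul_comm, ← lie_skew, slh_lie_slx, ← neg_smul, TensorProduct.tmul_smul,
    current_smul_lie]

/-- The defining relations of `W(1)`. -/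
structure IsWeylVector (w : M) : Prop where
  x_lie : ∀ p : ℂ[X], ⁅p ⊗ₜ[ℂ] slx, w⁆ = 0
  h_lie : ⁅(1 : ℂ[X]) ⊗ₜ[ℂ] slh, w⁆ = w
  y_lie : ⁅(1 : ℂ[X]) ⊗ₜ[ℂ] sly, ⁅(1 : ℂ[X]) ⊗ₜ[ℂ] sly, w⁆⁆ = 0

namespace IsWeylVector

variable {w : M} (hw : IsWeylVector w)
include hw

theorem x_h (p q : ℂ[X]) : ⁅p ⊗ₜ[ℂ] slx, ⁅q ⊗ₜ[ℂ] slh, w⁆⁆ = 0 := by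
  rw [lie_x_h, hw.x_lie, hw.x_lie, lie_zero, smul_zero, add_zero]

omit [Module ℂ M] [LieModule ℂ Current M] in
theorem x_y (p q : ℂ[X]) : ⁅p ⊗ₜ[ℂ] slx, ⁅q ⊗ₜ[ℂ] sly, w⁆⁆ = ⁅(p * q) ⊗ₜ[ℂ] slh, w⁆ := by
  rw [lie_x_y, hw.x_lie, lie_zero, add_zero]

/-- Applying `x ⊗ q` to `(y ⊗ 1)² w = 0` gives twice this relation. -/
theorem y_one_h (q : ℂ[X]) :
    ⁅(1 : ℂ[X]) ⊗ₜ[ℂ] sly, ⁅q ⊗ₜ[ℂ] slh, w⁆⁆ = ⁅q ⊗ₜ[ℂ] sly, w⁆ := by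
  have h := congrArg (fun m => ⁅q ⊗ₜ[ℂ] slx, m⁆) hw.y_lie
  simp only [lie_zero, lie_x_y, lie_h_y, hw.x_lie, add_zero, mul_one] at h
  linear_combination (norm := module) (1 / 2 : ℂ) • h

/-- Obtained by applying `x ⊗ p` to `y_one_h`. -/
theorem h_h (p q : ℂ[X]) : ⁅p ⊗ₜ[ℂ] slh, ⁅q ⊗ₜ[ℂ] slh, w⁆⁆ = ⁅(p * q) ⊗ₜ[ℂ] slh, w⁆ := by
  have h := congrArg (fun m => ⁅p ⊗ₜ[ℂ] slx, m⁆) (hw.y_one_h q)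
  simpa only [lie_x_y, hw.x_h, hw.x_lie, lie_zero, add_zero, mul_one] using h

theorem y_h (p q : ℂ[X]) : ⁅p ⊗ₜ[ℂ] sly, ⁅q ⊗ₜ[ℂ] slh, w⁆⁆ = ⁅(p * q) ⊗ₜ[ℂ] sly, w⁆ := by
  have key (p q : ℂ[X]) : (-2 : ℂ) • ⁅p ⊗ₜ[ℂ] sly, ⁅q ⊗ₜ[ℂ] slh, w⁆⁆ + ⁅(p * q) ⊗ₜ[ℂ] sly, w⁆ =
      (-2 : ℂ) • ⁅(p * q) ⊗ₜ[ℂ] sly, w⁆ + ⁅q ⊗ₜ[ℂ] sly, ⁅p ⊗ₜ[ℂ] slh, w⁆⁆ := by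
    have h := congrArg (fun m => ⁅p ⊗ₜ[ℂ] slh, m⁆) (hw.y_one_h q)
    rwa [lie_h_y p 1, hw.h_h, hw.y_one_h, lie_h_y p q, mul_one] at h
  have h1 := key p q
  have h2 := key q p
  rw [mul_comm q p] at h2
  -- With `A = (y ⊗ p)(h ⊗ q)w`, `B = (y ⊗ q)(h ⊗ p)w` and `Y = (y ⊗ pq)w`, the system is `2A + B =
  -- 3Y = A + 2B`, whence `A = Y`.
  linear_combination (norm := module) (-2 / 3 : ℂ) • h1 + (1 / 3 : ℂ) • h2

theorem h_y (p q : ℂ[X]) : ⁅p ⊗ₜ[ℂ] slh, ⁅q ⊗ₜ[ℂ] sly, w⁆⁆ = -⁅(p * q) ⊗ₜ[ℂ] sly, w⁆ := by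
  rw [lie_h_y, hw.y_h, mul_comm q p]
  module

/-- Applying `h ⊗ p` to `(y ⊗ 1)² w = 0` gives `-3` times the left side. One more application of an
`h ⊗ q` yields `y_y`. -/
theorem y_y_one (p : ℂ[X]) : ⁅p ⊗ₜ[ℂ] sly, ⁅(1 : ℂ[X]) ⊗ₜ[ℂ] sly, w⁆⁆ = 0 := by
  have h := congrArg (fun m => ⁅p ⊗ₜ[ℂ] slh, m⁆) hw.y_lie
  have hc : ⁅(1 : ℂ[X]) ⊗ₜ[ℂ] sly, ⁅p ⊗ₜ[ℂ] sly, w⁆⁆ =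
      ⁅p ⊗ₜ[ℂ] sly, ⁅(1 : ℂ[X]) ⊗ₜ[ℂ] sly, w⁆⁆ := by
    rw [lie_tmul_comm, lie_self, TensorProduct.tmul_zero, zero_lie, zero_add]
  simp only [lie_zero, lie_h_y p 1 ⁅_, w⁆, hw.h_y, mul_one, lie_neg, hc] at h
  linear_combination (norm := module) (-1 / 3 : ℂ) • h

theorem y_y (p q : ℂ[X]) : ⁅p ⊗ₜ[ℂ] sly, ⁅q ⊗ₜ[ℂ] sly, w⁆⁆ = 0 := by
  have h := congrArg (fun m => ⁅q ⊗ₜ[ℂ] slh, m⁆) (hw.y_y_one p)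
  rwa [lie_h_y q p, hw.h_y, hw.y_y_one, mul_one, lie_neg, smul_zero, lie_zero, zero_add,
    neg_eq_zero] at h

end IsWeylVector

/-! ### The model `V(1) ⊗ ℂ[t]` -/

/-- The `j`-th coordinate `V(1) ⊗ ℂ[t] → ℂ[t]`. -/
def coord (j : Fin 2) : NatRepT →ₗ[ℂ] ℂ[X] :=
  TensorProduct.lift ((LinearMap.lsmul ℂ ℂ[X]).comp
    (LinearMap.proj j : (Fin 2 → ℂ) →ₗ[ℂ] ℂ) : NatRep →ₗ[ℂ] ℂ[X] →ₗ[ℂ] ℂ[X]).flip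

theorem coord_tmul (j : Fin 2) (p : ℂ[X]) (v : NatRep) :
    coord j (p ⊗ₜ[ℂ] v) = @id (Fin 2 → ℂ) v j • p := rfl

/-- The basis vector `e₂` of `V(1)`. -/
def e2 : NatRep := (![0, 1] : Fin 2 → ℂ)

theorem natRep_eq (v : NatRep) :
    v = @id (Fin 2 → ℂ) v 0 • e1 + @id (Fin 2 → ℂ) v 1 • e2 := by
  have h (u : Fin 2 → ℂ) : u = u 0 • ![1, 0] + u 1 • ![0, 1] := by
    ext i
    fin_cases i <;> simp
  exact h v

theorem natRepT_eq (m : NatRepT) : m = coord 0 m ⊗ₜ[ℂ] e1 + coord 1 m ⊗ₜ[ℂ] e2 := by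
  induction m using TensorProduct.induction_on with
  | zero => simp
  | tmul p v =>
    rw [coord_tmul, coord_tmul, TensorProduct.smul_tmul, TensorProduct.smul_tmul,
      ← TensorProduct.tmul_add, ← natRep_eq]
  | add a b ha hb =>
    rw [map_add, map_add, TensorProduct.add_tmul, TensorProduct.add_tmul]
    nth_rw 1 [ha, hb]
    abel

theorem slx_e1 : ⁅slx, e1⁆ = 0 := by
  have h : Matrix.mulVec !![0, 1; 0, 0] ![1, 0] = (0 : Fin 2 → ℂ) := by
    ext i; fin_cases i <;> simp
  exact h

theorem slx_e2 : ⁅slx, e2⁆ = e1 := by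
  change Matrix.mulVec !![0, 1; 0, 0] ![0, 1] = ![1, 0]
  ext i; fin_cases i <;> simp

theorem sly_e1 : ⁅sly, e1⁆ = e2 := by
  change Matrix.mulVec !![0, 0; 1, 0] ![1, 0] = ![0, 1]
  ext i; fin_cases i <;> simp

theorem sly_e2 : ⁅sly, e2⁆ = 0 := by
  have h : Matrix.mulVec !![0, 0; 1, 0] ![0, 1] = (0 : Fin 2 → ℂ) := by
    ext i; fin_cases i <;> simp
  exact h

theorem slh_e1 : ⁅slh, e1⁆ = e1 := by
  change Matrix.mulVec !![1, 0; 0, -1] ![1, 0] = ![1, 0]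
  ext i; fin_cases i <;> simp

theorem slh_e2 : ⁅slh, e2⁆ = -e2 := by
  have h : Matrix.mulVec !![1, 0; 0, -1] ![0, 1] = -(![0, 1] : Fin 2 → ℂ) := by
    ext i; fin_cases i <;> simp
  exact h

theorem natRepT_add_lie (a b : Current) (m : NatRepT) : ⁅a + b, m⁆ = ⁅a, m⁆ + ⁅b, m⁆ :=
  add_lie a b m

theorem natRepT_lie_add (a : Current) (m n : NatRepT) : ⁅a, m + n⁆ = ⁅a, m⁆ + ⁅a, n⁆ :=
  lie_add a m n

theorem natRepT_smul_lie (c : ℂ) (a : Current) (m : NatRepT) : ⁅c • a, m⁆ = c • ⁅a, m⁆ :=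
  smul_lie c a m

theorem natRepT_zero_lie (m : NatRepT) : ⁅(0 : Current), m⁆ = 0 := zero_lie m

theorem lie_tmul (p q : ℂ[X]) (a : Sl2) (v : NatRep) :
    ⁅p ⊗ₜ[ℂ] a, q ⊗ₜ[ℂ] v⁆ = (p * q) ⊗ₜ[ℂ] ⁅a, v⁆ := rfl

/-- The linear map `p ↦ (p ⊗ a) w`. -/
def orbitMap (a : Sl2) (w : M) : ℂ[X] →ₗ[ℂ] M where
  toFun p := ⁅p ⊗ₜ[ℂ] a, w⁆
  map_add' p q := by rw [TensorProduct.add_tmul, current_add_lie]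
  map_smul' c p := by rw [← TensorProduct.smul_tmul', current_smul_lie, RingHom.id_apply]

/-- The map from `V(1) ⊗ ℂ[t]` to a module with a vector satisfying the relations of `W(1)`. -/
def evalWeyl (w : M) : NatRepT →ₗ[ℂ] M :=
  -- Forced by equivariance: in the model, `h ⊗ p` and `y ⊗ p` send `e₁ ⊗ 1` to `e₁ ⊗ p` and `e₂ ⊗
  -- p`.
  orbitMap slh w ∘ₗ coord 0 + orbitMap sly w ∘ₗ coord 1

theorem evalWeyl_e1 (w : M) (p : ℂ[X]) : evalWeyl w (p ⊗ₜ[ℂ] e1) = ⁅p ⊗ₜ[ℂ] slh, w⁆ := by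
  rw [evalWeyl, LinearMap.add_apply, LinearMap.comp_apply, LinearMap.comp_apply,
    coord_tmul, coord_tmul]
  simp [orbitMap, e1]

theorem evalWeyl_e2 (w : M) (p : ℂ[X]) : evalWeyl w (p ⊗ₜ[ℂ] e2) = ⁅p ⊗ₜ[ℂ] sly, w⁆ := by
  rw [evalWeyl, LinearMap.add_apply, LinearMap.comp_apply, LinearMap.comp_apply,
    coord_tmul, coord_tmul]
  simp [orbitMap, e2]

/-- On the bases of `sl₂` and `V(1)`, equivariance amounts to the six product relations of
`IsWeylVector`. -/
theorem evalWeyl_lie {w : M} (hw : IsWeylVector w) (a : Current) (m : NatRepT) :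
    evalWeyl w ⁅a, m⁆ = ⁅a, evalWeyl w m⁆ := by
  induction a using TensorProduct.induction_on with
  | zero => rw [natRepT_zero_lie, current_zero_lie, map_zero]
  | add a b ha hb => rw [natRepT_add_lie, current_add_lie, map_add, ha, hb]
  | tmul p a =>
    rw [natRepT_eq m]
    generalize coord 0 m = q, coord 1 m = r
    rw [sl2_eq a]
    simp only [TensorProduct.tmul_add, TensorProduct.tmul_smul, current_add_lie, current_smul_lie, lie_add,
      natRepT_add_lie, natRepT_smul_lie, natRepT_lie_add, map_add, map_smul, lie_tmul, slx_e1, slx_e2, sly_e1, sly_e2, slh_e1, slh_e2,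
      TensorProduct.tmul_zero, TensorProduct.tmul_neg, map_neg, map_zero, evalWeyl_e1, evalWeyl_e2,
      hw.x_h, hw.x_y, hw.y_h, hw.y_y, hw.h_h, hw.h_y]

theorem isWeylVector_e1 : IsWeylVector ((1 : ℂ[X]) ⊗ₜ[ℂ] e1 : NatRepT) where
  x_lie p := by rw [lie_tmul, slx_e1, TensorProduct.tmul_zero]
  h_lie := by rw [lie_tmul, slh_e1, one_mul]
  y_lie := by rw [lie_tmul, lie_tmul, sly_e1, sly_e2, TensorProduct.tmul_zero]

/-! ### The universal property of `W(1)` and its identification with the model -/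

/-- The class of an element of the enveloping algebra in `W(l)`. -/
def weylMk (l : ℕ) (u : Env) : Weyl l := Submodule.Quotient.mk (p := weylIdeal l) u

theorem weylMk_surjective (l : ℕ) : Function.Surjective (weylMk l) :=
  Submodule.Quotient.mk_surjective (weylIdeal l)

theorem weylMk_one (l : ℕ) : weylMk l 1 = weylGen l := rfl

theorem weylMk_lie (l : ℕ) (a : Current) (u : Env) : ⁅a, weylMk l u⁆ = weylMk l (envι a * u) := rfl

theorem smul_weylMk (l : ℕ) (u v : Env) : u • weylMk l v = weylMk l (u * v) := rfl

theorem isWeylVector_weylGen : IsWeylVector (weylGen 1) where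
  x_lie p := by
    rw [← weylMk_one, weylMk_lie, mul_one]
    exact (Submodule.Quotient.mk_eq_zero _).2 (Submodule.subset_span (Or.inl ⟨p, rfl⟩))
  h_lie := by
    rw [← weylMk_one, weylMk_lie, mul_one]
    refine (Submodule.Quotient.eq _).2 (Submodule.subset_span (Or.inr (Or.inl ?_)))
    simp
  y_lie := by
    rw [← weylMk_one, weylMk_lie, weylMk_lie, mul_one]
    refine (Submodule.Quotient.mk_eq_zero _).2 (Submodule.subset_span (Or.inr (Or.inr ?_)))
    rw [Set.mem_singleton_iff, pow_two]

/-- The action of the enveloping algebra on a module. -/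
def envAct (M : Type*) [AddCommGroup M] [Module ℂ M] [LieRingModule Current M]
    [LieModule ℂ Current M] : Env →ₐ[ℂ] Module.End ℂ M :=
  UniversalEnvelopingAlgebra.lift ℂ (LieModule.toEnd ℂ Current M)

theorem envAct_ι (a : Current) (m : M) : envAct M (envι a) m = ⁅a, m⁆ := by
  rw [envAct, UniversalEnvelopingAlgebra.lift_ι_apply]
  rfl

theorem envAct_weylIdeal {w : M} (hw : IsWeylVector w) {u : Env} (hu : u ∈ weylIdeal 1) :
    envAct M u w = 0 := by
  induction hu using Submodule.span_induction with
  | mem u hu =>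
    rcases hu with ⟨p, rfl⟩ | rfl | rfl
    · simp only [envAct_ι, hw.x_lie]
    · simp only [map_sub, LinearMap.sub_apply, envAct_ι, hw.h_lie, AlgHom.commutes]
      simp
    · simp only [pow_succ, pow_zero, one_mul, map_mul, Module.End.mul_apply, envAct_ι, hw.y_lie]
  | zero => simp
  | add a b _ _ ha hb => rw [map_add, LinearMap.add_apply, ha, hb, add_zero]
  | smul c a _ ha => rw [smul_eq_mul, map_mul, Module.End.mul_apply, ha, map_zero]

/-- The universal property of `W(1)`. -/
def weylLift {w : M} (hw : IsWeylVector w) : Weyl 1 →ₗ[ℂ] M :=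
  ((weylIdeal 1).restrictScalars ℂ).liftQ ((envAct M).toLinearMap.flip w)
    fun _ hu => envAct_weylIdeal hw hu

theorem weylLift_mk {w : M} (hw : IsWeylVector w) (u : Env) :
    weylLift hw (weylMk 1 u) = envAct M u w := rfl

theorem weylLift_weylGen {w : M} (hw : IsWeylVector w) : weylLift hw (weylGen 1) = w := by
  rw [← weylMk_one, weylLift_mk, map_one, Module.End.one_apply]

theorem weylLift_lie {w : M} (hw : IsWeylVector w) (a : Current) (m : Weyl 1) :
    weylLift hw ⁅a, m⁆ = ⁅a, weylLift hw m⁆ := by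
  obtain ⟨u, rfl⟩ := weylMk_surjective 1 m
  rw [weylMk_lie, weylLift_mk, weylLift_mk, map_mul, Module.End.mul_apply, envAct_ι]

/-- The universal property maps `Env` to this subalgebra; followed by the inclusion, this is the
identity by uniqueness. -/
theorem env_mem_adjoin (u : Env) : u ∈ Algebra.adjoin ℂ (Set.range envι) := by
  let f : Current →ₗ⁅ℂ⁆ Algebra.adjoin ℂ (Set.range envι) :=
    { toFun a := ⟨envι a, Algebra.subset_adjoin ⟨a, rfl⟩⟩
      map_add' a b := Subtype.ext (map_add envι a b)
      map_smul' c a := Subtype.ext (map_smul envι c a)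
      map_lie' {a b} := Subtype.ext (LieHom.map_lie envι a b) }
  have h : (Subalgebra.val _).comp (UniversalEnvelopingAlgebra.lift ℂ f) = AlgHom.id ℂ Env := by
    refine UniversalEnvelopingAlgebra.hom_ext ℂ (LieHom.ext fun a => ?_)
    change ((UniversalEnvelopingAlgebra.lift ℂ f (envι a) : Algebra.adjoin ℂ (Set.range envι)) :
      Env) = envι a
    rw [UniversalEnvelopingAlgebra.lift_ι_apply]
    rfl
  have h2 := DFunLike.congr_fun h u
  rw [AlgHom.id_apply] at h2
  rw [← h2]
  exact Subtype.property _

/-- A subspace of `W(1)` that contains the generator and is stable is everything. -/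
theorem weyl_induction {N : Submodule ℂ (Weyl 1)} (hg : weylGen 1 ∈ N)
    (hN : ∀ (a : Current), ∀ m ∈ N, ⁅a, m⁆ ∈ N) (m : Weyl 1) : m ∈ N := by
  have key : ∀ u : Env, ∀ m ∈ N, u • m ∈ N := by
    intro u
    induction env_mem_adjoin u using Algebra.adjoin_induction with
    | mem _ h =>
      obtain ⟨a, rfl⟩ := h
      exact fun m hm => hN a m hm
    | algebraMap c =>
      intro m hm
      rw [algebraMap_smul]
      exact N.smul_mem c hm
    | mul a b _ _ ha hb => exact fun m hm => by rw [mul_smul]; exact ha _ (hb m hm)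
    | add a b _ _ ha hb => exact fun m hm => by rw [add_smul]; exact N.add_mem (ha m hm) (hb m hm)
  obtain ⟨u, rfl⟩ := weylMk_surjective 1 m
  have h := key u _ hg
  rwa [← weylMk_one, smul_weylMk, mul_one] at h

/-- The identification of `W(1)` with `V(1) ⊗ ℂ[t]`. -/
def weylEquiv : Weyl 1 ≃ₗ⁅ℂ, Current⁆ NatRepT where
  __ := weylLift isWeylVector_e1
  map_lie' := weylLift_lie isWeylVector_e1 _ _
  invFun := evalWeyl (weylGen 1)
  left_inv m := by
    -- Both maps are equivariant, so the locus where their composite is the identity is stable; it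
    -- contains the generator.
    refine weyl_induction (N := LinearMap.eqLocus
      (evalWeyl (weylGen 1) ∘ₗ weylLift isWeylVector_e1) LinearMap.id) ?_ ?_ m
    · rw [LinearMap.mem_eqLocus, LinearMap.comp_apply, weylLift_weylGen, evalWeyl_e1,
        isWeylVector_weylGen.h_lie, LinearMap.id_apply]
    · intro a m hm
      rw [LinearMap.mem_eqLocus, LinearMap.comp_apply, LinearMap.id_apply] at hm ⊢
      rw [weylLift_lie, evalWeyl_lie isWeylVector_weylGen, hm]
  right_inv m := by
    change weylLift isWeylVector_e1 (evalWeyl (weylGen 1) m) = m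
    rw [natRepT_eq m]
    simp only [map_add, evalWeyl_e1, evalWeyl_e2, weylLift_lie, weylLift_weylGen, lie_tmul,
      slh_e1, sly_e1, mul_one]

theorem weylEquiv_weylGen : weylEquiv (weylGen 1) = (1 : ℂ[X]) ⊗ₜ[ℂ] e1 :=
  weylLift_weylGen isWeylVector_e1


/-! ### Polynomial components of tensors -/

/-- Coordinates on an `sl₂[t]`-module that identify it with `V(1) ⊗ ℂ[t]` as a module over the
subalgebra spanned by the `x ⊗ p` and the `h ⊗ p`. -/
structure NatCoordinates {M : Type*} [AddCommGroup M] [Module ℂ M] [LieRingModule Current M]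
    [LieModule ℂ Current M] (c : Fin 2 → M →ₗ[ℂ] ℂ[X]) : Prop where
  bijective : Function.Bijective (LinearMap.pi c)
  x_zero : ∀ (p : ℂ[X]) (m : M), c 0 ⁅p ⊗ₜ[ℂ] slx, m⁆ = p * c 1 m
  x_one : ∀ (p : ℂ[X]) (m : M), c 1 ⁅p ⊗ₜ[ℂ] slx, m⁆ = 0
  h_zero : ∀ (p : ℂ[X]) (m : M), c 0 ⁅p ⊗ₜ[ℂ] slh, m⁆ = p * c 0 m
  h_one : ∀ (p : ℂ[X]) (m : M), c 1 ⁅p ⊗ₜ[ℂ] slh, m⁆ = -(p * c 1 m)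

section Model

variable {n : ℕ} {M : Type*} [AddCommGroup M] [Module ℂ M] (c : Fin 2 → M →ₗ[ℂ] ℂ[X])

/-- The substitution of `tᵢ` for `t`. -/
def atVar (i : Fin n) : ℂ[X] →ₐ[ℂ] MvPolynomial (Fin n) ℂ := Polynomial.aeval (MvPolynomial.X i)

/-- The components of a tensor in `V(1)^{⊗ n} ⊗ ℂ[t₁, …, tₙ]` with respect to the standard basis
of `V(1)^{⊗ n}`. -/
def tensorCoord (n : ℕ) : TPow n M →ₗ[ℂ] ((Fin n → Fin 2) → MvPolynomial (Fin n) ℂ) :=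
  PiTensorProduct.lift (MultilinearMap.pi fun s =>
    (MultilinearMap.mkPiAlgebra ℂ (Fin n) (MvPolynomial (Fin n) ℂ)).compLinearMap
      fun i => (atVar i).toLinearMap ∘ₗ c (s i))

theorem tensorCoord_tprod (v : Fin n → M) (s : Fin n → Fin 2) :
    tensorCoord c n (PiTensorProduct.tprod ℂ v) s = ∏ i, atVar i (c (s i) (v i)) := by
  rw [tensorCoord, PiTensorProduct.lift.tprod]
  rfl

/-- Isolates the factor at `i`, where a Leibniz term differs from the original tensor. The free
index `j` allows for operators that change the word. -/
theorem tensorCoord_update (v : Fin n → M) (s : Fin n → Fin 2) (i : Fin n) (j : Fin 2) (y : M) :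
    tensorCoord c n (PiTensorProduct.tprod ℂ (Function.update v i y)) (Function.update s i j) =
      atVar i (c j y) * ∏ k ∈ Finset.univ.erase i, atVar k (c (s k) (v k)) := by
  rw [tensorCoord_tprod, ← Finset.mul_prod_erase _ _ (Finset.mem_univ i)]
  congr 1
  · simp
  · refine Finset.prod_congr rfl fun k hk => ?_
    have hk' := Finset.ne_of_mem_erase hk
    simp [hk']

theorem tensorCoord_permAct (σ : Equiv.Perm (Fin n)) (m : TPow n M) (s : Fin n → Fin 2) :
    tensorCoord c n (permAct n σ m) s = MvPolynomial.rename σ (tensorCoord c n m (s ∘ σ)) := by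
  induction m using PiTensorProduct.induction_on with
  | smul_tprod r v =>
    have h (i : Fin n) (p : ℂ[X]) : MvPolynomial.rename σ (atVar i p) = atVar (σ i) p := by
      rw [atVar, atVar, ← Polynomial.aeval_algHom_apply, MvPolynomial.rename_X]
    simp only [map_smul, Pi.smul_apply, permAct_tprod, tensorCoord_tprod, map_prod, h]
    rw [← Equiv.prod_comp σ]
    exact congrArg (r • ·) (Finset.prod_congr rfl fun i _ =>
      congrArg (fun k => atVar (σ i) (c (s (σ i)) (v k))) (σ.symm_apply_apply i))
  | add a b ha hb => simp only [map_add, Pi.add_apply, ha, hb]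

variable {c}

/-- The tensor product basis corresponds bijectively to pairs of a word and a monomial, so the
coefficients of the components are exactly the coordinates of the tensor. -/
theorem tensorCoord_injective (hc : Function.Bijective (LinearMap.pi c)) :
    Function.Injective (tensorCoord c n) := by
  let b : Module.Basis (Σ _ : Fin 2, ℕ) ℂ M :=
    (Pi.basis fun _ => Polynomial.basisMonomials ℂ).map (LinearEquiv.ofBijective _ hc).symm
  have hb (q : Σ _ : Fin 2, ℕ) (j : Fin 2) :
      c j (b q) = if j = q.1 then Polynomial.X ^ q.2 else 0 := by
    have h : LinearMap.pi c (b q) = Pi.single q.1 (Polynomial.X ^ q.2 : ℂ[X]) := by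
      have h1 := (LinearEquiv.ofBijective _ hc).apply_symm_apply
        ((Pi.basis fun _ : Fin 2 => Polynomial.basisMonomials ℂ) q)
      rw [Pi.basis_apply, Polynomial.coe_basisMonomials] at h1
      rw [← Polynomial.monomial_one_right_eq_X_pow, Module.Basis.map_apply, Pi.basis_apply,
        Polynomial.coe_basisMonomials]
      exact h1
    rw [← LinearMap.pi_apply c, h, Pi.single_apply]
  let B := Basis.piTensorProduct fun _ : Fin n => b
  have hB (q : Fin n → Σ _ : Fin 2, ℕ) (s : Fin n → Fin 2) : tensorCoord c n (B q) s =
      if (fun i => (q i).1) = s then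
        MvPolynomial.monomial (Finsupp.equivFunOnFinite.symm fun i => (q i).2) 1 else 0 := by
    rw [Basis.piTensorProduct_apply, tensorCoord_tprod]
    split_ifs with hs
    · subst hs
      rw [MvPolynomial.monomial_eq, Finsupp.prod_fintype _ _ (by simp)]
      simp [hb, atVar]
    · obtain ⟨i, hi⟩ := Function.ne_iff.1 hs
      refine Finset.prod_eq_zero (Finset.mem_univ i) ?_
      rw [hb, if_neg (Ne.symm hi), map_zero]
  have key (p : Fin n → Σ _ : Fin 2, ℕ) (m : TPow n M) :
      MvPolynomial.coeff (Finsupp.equivFunOnFinite.symm fun i => (p i).2)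
        (tensorCoord c n m fun i => (p i).1) = B.repr m p := by
    have h : (MvPolynomial.lcoeff ℂ (Finsupp.equivFunOnFinite.symm fun i => (p i).2)) ∘ₗ
        LinearMap.proj (fun i => (p i).1) ∘ₗ tensorCoord c n = B.coord p := by
      refine B.ext fun q => ?_
      simp only [LinearMap.comp_apply, LinearMap.proj_apply, MvPolynomial.lcoeff_apply, hB,
        Module.Basis.coord_apply, Module.Basis.repr_self, Finsupp.single_apply]
      by_cases hqp : q = p
      · subst hqp
        simp
      · rw [if_neg hqp]
        split_ifs with h1
        · rw [MvPolynomial.coeff_monomial, if_neg]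
          intro h2
          refine hqp (funext fun i => Sigma.ext (congrFun h1 i) (heq_of_eq ?_))
          exact congrFun (Finsupp.equivFunOnFinite.symm.injective h2) i
        · rfl
    exact DFunLike.congr_fun h m
  refine (injective_iff_map_eq_zero _).2 fun m hm => B.repr.injective ?_
  ext p
  rw [← key, hm]
  simp

end Model

/-! ### The action on components, highest weight vectors and the three claims -/

section Action

variable {n : ℕ} {M : Type*} [AddCommGroup M] [Module ℂ M] [LieRingModule Current M]
  [LieModule ℂ Current M] {c : Fin 2 → M →ₗ[ℂ] ℂ[X]} (hc : NatCoordinates c)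
include hc

namespace NatCoordinates

theorem tensorCoord_h (p : ℂ[X]) (m : TPow n M) (s : Fin n → Fin 2) :
    tensorCoord c n ⁅p ⊗ₜ[ℂ] slh, m⁆ s =
      (∑ i, if s i = 0 then atVar i p else -atVar i p) * tensorCoord c n m s := by
  induction m using PiTensorProduct.induction_on with
  | smul_tprod r v =>
    simp only [lie_smul, map_smul, Pi.smul_apply, mul_smul_comm]
    rw [lie_tprod, map_sum, Finset.sum_apply, Finset.sum_mul]
    congr 1
    refine Finset.sum_congr rfl fun i _ => ?_
    have h1 := tensorCoord_update c v s i (s i) ⁅p ⊗ₜ[ℂ] slh, v i⁆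
    have h2 := tensorCoord_update c v s i (s i) (v i)
    rw [Function.update_eq_self] at h1
    rw [Function.update_eq_self, Function.update_eq_self] at h2
    rw [h1, h2, ← mul_assoc]
    congr 1
    split_ifs with h
    · rw [h, hc.h_zero, map_mul]
    · rw [Fin.eq_one_of_ne_zero _ h, hc.h_one, map_neg, map_mul, neg_mul]
  | add a b ha hb => simp only [lie_add, map_add, Pi.add_apply, ha, hb, mul_add]

/-- Since `x` kills `e₁` and sends `e₂` to `e₁`, the component at `s` is fed only by words with one
`e₁` of `s` replaced by `e₂`. -/
theorem tensorCoord_x (p : ℂ[X]) (m : TPow n M) (s : Fin n → Fin 2) :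
    tensorCoord c n ⁅p ⊗ₜ[ℂ] slx, m⁆ s =
      ∑ i, if s i = 0 then atVar i p * tensorCoord c n m (Function.update s i 1) else 0 := by
  induction m using PiTensorProduct.induction_on with
  | smul_tprod r v =>
    simp only [lie_smul, map_smul, Pi.smul_apply, mul_smul_comm]
    rw [lie_tprod, map_sum, Finset.sum_apply, Finset.smul_sum]
    refine Finset.sum_congr rfl fun i _ => ?_
    have h1 := tensorCoord_update c v s i (s i) ⁅p ⊗ₜ[ℂ] slx, v i⁆
    have h2 := tensorCoord_update c v s i 1 (v i)
    rw [Function.update_eq_self] at h1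
    rw [Function.update_eq_self] at h2
    rw [h1, h2]
    split_ifs with h
    · rw [h, hc.x_zero, map_mul, mul_assoc]
    · rw [Fin.eq_one_of_ne_zero _ h, hc.x_one, map_zero, zero_mul, smul_zero]
  | add a b ha hb =>
    simp only [lie_add, map_add, Pi.add_apply, ha, hb, mul_add, ← Finset.sum_add_distrib]
    refine Finset.sum_congr rfl fun i _ => ?_
    split_ifs <;> simp

end NatCoordinates

/-- The tensors supported on `e₁^{⊗ n}`. -/
def highest (c : Fin 2 → M →ₗ[ℂ] ℂ[X]) (n : ℕ) : Submodule ℂ (TPow n M) where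
  carrier := {m | ∀ s : Fin n → Fin 2, s ≠ 0 → tensorCoord c n m s = 0}
  add_mem' ha hb s hs := by rw [map_add, Pi.add_apply, ha s hs, hb s hs, add_zero]
  zero_mem' s _ := by rw [map_zero, Pi.zero_apply]
  smul_mem' r m hm s hs := by rw [map_smul, Pi.smul_apply, hm s hs, smul_zero]

namespace NatCoordinates

theorem ext_of_mem_highest {m m' : TPow n M} (hm : m ∈ highest c n) (hm' : m' ∈ highest c n)
    (h : tensorCoord c n m 0 = tensorCoord c n m' 0) : m = m' := by
  refine tensorCoord_injective hc.bijective (funext fun s => ?_)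
  rcases eq_or_ne s 0 with rfl | hs
  · exact h
  · rw [hm s hs, hm' s hs]

theorem h_lie_mem_highest {m : TPow n M} (hm : m ∈ highest c n) (p : ℂ[X]) :
    ⁅p ⊗ₜ[ℂ] slh, m⁆ ∈ highest c n := fun s hs => by
  rw [hc.tensorCoord_h, hm s hs, mul_zero]

theorem mem_highest_of_x_lie {m : TPow n M}
    (hm : ∀ r : ℕ, ⁅(Polynomial.X ^ r : ℂ[X]) ⊗ₜ[ℂ] slx, m⁆ = 0) : m ∈ highest c n := by
  intro s hs
  obtain ⟨i, hi⟩ := Function.ne_iff.1 hs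
  have hi1 : s i = 1 := Fin.eq_one_of_ne_zero _ hi
  -- Reading the component at `s` with its `i`-th letter reset to `0`, for each `r`, gives a
  -- Vandermonde system in the distinct variables `tⱼ`. Its `i`-th unknown is the component at `s`
  -- itself.
  have key := Matrix.eq_zero_of_forall_pow_sum_mul_pow_eq_zero
    (f := fun j : Fin n => (MvPolynomial.X j : MvPolynomial (Fin n) ℂ))
    (v := fun j => if Function.update s i 0 j = 0 then
      tensorCoord c n m (Function.update (Function.update s i 0) j 1) else 0)
    MvPolynomial.X_injective fun r => by
      have h := hc.tensorCoord_x (Polynomial.X ^ (r : ℕ)) m (Function.update s i 0)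
      rw [hm, map_zero, Pi.zero_apply] at h
      refine Eq.trans (Finset.sum_congr rfl fun j _ => ?_) h.symm
      split_ifs
      · simp [atVar, mul_comm]
      · rw [zero_mul]
  have h := congrFun key i
  simpa [← hi1] using h

theorem mem_weightSpace_iff {m : TPow n M} :
    m ∈ weightSpace (TPow n M) (n : ℤ) ↔ m ∈ highest c n := by
  have hw : m ∈ weightSpace (TPow n M) (n : ℤ) ↔ ⁅(1 : ℂ[X]) ⊗ₜ[ℂ] slh, m⁆ = (n : ℂ) • m := by
    rw [weightSpace, Module.End.mem_eigenspace_iff, LieModule.toEnd_apply_apply, Int.cast_natCast]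
  rw [hw, ← (tensorCoord_injective hc.bijective).eq_iff, funext_iff]
  refine forall_congr' fun s => ?_
  have hs : (∑ i : Fin n, if s i = 0 then atVar i (1 : ℂ[X]) else -atVar i (1 : ℂ[X])) =
      ((∑ i : Fin n, if s i = 0 then (1 : ℤ) else -1 : ℤ) : MvPolynomial (Fin n) ℂ) := by
    push_cast
    refine Finset.sum_congr rfl fun i _ => ?_
    split_ifs <;> simp
  have hn : (n : ℂ) • tensorCoord c n m s = ((n : ℤ) : MvPolynomial (Fin n) ℂ) *
      tensorCoord c n m s := by
    rw [Nat.cast_smul_eq_nsmul, nsmul_eq_mul, Int.cast_natCast]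
  rw [hc.tensorCoord_h, map_smul, Pi.smul_apply, hs, hn, mul_eq_mul_right_iff, Int.cast_inj,
    or_iff_not_imp_left]
  refine imp_congr_left (not_congr ?_)
  have hsum : (n : ℤ) = ∑ _i : Fin n, (1 : ℤ) := by simp
  -- A sum of `n` signs equals `n` only if every sign is `+1`.
  rw [hsum, Finset.sum_eq_sum_iff_of_le fun i _ => by split_ifs <;> simp, funext_iff]
  refine forall_congr' fun i => ?_
  by_cases h : s i = 0 <;> simp [h]

/-- Induction on a strict upper bound `d` for the number of letters `e₂` in the words that occur; a
nonzero `(x ⊗ t ^ r) m` lowers it by one. -/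
theorem exists_mem_highest {N : Submodule ℂ (TPow n M)}
    (hN : ∀ a : Current, ∀ m ∈ N, ⁅a, m⁆ ∈ N) (h0 : N ≠ ⊥) :
    ∃ m ∈ N, m ≠ 0 ∧ m ∈ highest c n := by
  have key : ∀ d : ℕ, ∀ m ∈ N, m ≠ 0 →
      (∀ s : Fin n → Fin 2, d ≤ (Finset.univ.filter fun i => s i ≠ 0).card →
        tensorCoord c n m s = 0) → ∃ m ∈ N, m ≠ 0 ∧ m ∈ highest c n := by
    intro d
    induction d with
    | zero =>
      intro m _ hm hd
      refine absurd (tensorCoord_injective hc.bijective (funext fun s => ?_)) hm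
      rw [hd s (Nat.zero_le _), map_zero, Pi.zero_apply]
    | succ d ih =>
      intro m hmN hm hd
      by_cases hx : ∀ r : ℕ, ⁅(Polynomial.X ^ r : ℂ[X]) ⊗ₜ[ℂ] slx, m⁆ = 0
      · exact ⟨m, hmN, hm, hc.mem_highest_of_x_lie hx⟩
      · push Not at hx
        obtain ⟨r, hr⟩ := hx
        refine ih _ (hN _ m hmN) hr fun s hs => ?_
        rw [hc.tensorCoord_x]
        refine Finset.sum_eq_zero fun i _ => ?_
        split_ifs with hi
        · rw [hd, mul_zero]
          -- The source word has one more `e₂` than `s`, so the old bound makes its component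
          -- vanish.
          have h : insert i (Finset.univ.filter fun k => s k ≠ 0) ⊆
              Finset.univ.filter fun k => Function.update s i 1 k ≠ 0 := by
            intro k hk
            rcases eq_or_ne k i with rfl | hki
            · simp
            · simpa [hki] using hk
          refine le_trans ?_ (Finset.card_le_card h)
          rw [Finset.card_insert_of_notMem (by simp [hi])]
          omega
        · rfl
  obtain ⟨m, hmN, hm⟩ := N.ne_bot_iff.1 h0
  -- No word of length `n` has `n + 1` letters `e₂`.
  refine key (n + 1) m hmN hm fun s hs => ?_
  have := Finset.card_le_univ (Finset.univ.filter fun i => s i ≠ 0)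
  rw [Fintype.card_fin] at this
  omega

/-- A subspace that is stable under `h ⊗ ℂ[t]` is stable under multiplication by symmetric
polynomials on its part supported on `e₁^{⊗ n}`. -/
theorem exists_mul_isSymmetric {N : Submodule ℂ (TPow n M)}
    (hN : ∀ p : ℂ[X], ∀ m ∈ N, ⁅p ⊗ₜ[ℂ] slh, m⁆ ∈ N) {m : TPow n M} (hmN : m ∈ N)
    (hm : m ∈ highest c n) {g : MvPolynomial (Fin n) ℂ} (hg : g.IsSymmetric) :
    ∃ m' ∈ N, m' ∈ highest c n ∧ tensorCoord c n m' 0 = g * tensorCoord c n m 0 := by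
  have hg' := hg.mem_adjoin_psum
  clear hg
  induction hg' using Algebra.adjoin_induction generalizing m with
  | mem _ h =>
    obtain ⟨r, rfl⟩ := h
    refine ⟨_, hN (Polynomial.X ^ r) m hmN, hc.h_lie_mem_highest hm _, ?_⟩
    rw [hc.tensorCoord_h, MvPolynomial.psum]
    simp [atVar]
  | algebraMap r =>
    refine ⟨r • m, N.smul_mem r hmN, (highest c n).smul_mem r hm, ?_⟩
    rw [map_smul, Pi.smul_apply, Algebra.smul_def]
  | add f g _ _ hf hg =>
    obtain ⟨a, haN, ha, ha'⟩ := hf hmN hm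
    obtain ⟨b, hbN, hb, hb'⟩ := hg hmN hm
    exact ⟨a + b, N.add_mem haN hbN, (highest c n).add_mem ha hb, by
      rw [map_add, Pi.add_apply, ha', hb', add_mul]⟩
  | mul f g _ _ hf hg =>
    -- The second factor is applied to the vector produced by the first, which is why the induction
    -- generalizes `m`.
    obtain ⟨b, hbN, hb, hb'⟩ := hg hmN hm
    obtain ⟨a, haN, ha, ha'⟩ := hf hbN hb
    exact ⟨a, haN, ha, by rw [ha', hb', mul_assoc]⟩

omit hc in
theorem sign_smul (σ : Equiv.Perm (Fin n)) (f : MvPolynomial (Fin n) ℂ) :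
    (((Equiv.Perm.sign σ : ℤˣ) : ℤ) : ℂ) • f = ((Equiv.Perm.sign σ : ℤˣ) : ℤ) * f := by
  rw [Int.cast_smul_eq_zsmul, zsmul_eq_mul]

omit hc in
-- The word `s = 0` is fixed by all permutations, so its component inherits the sign character.
theorem exists_eq_vand_mul {m : TPow n M} (hm : m ∈ wedge n M) :
    ∃ g : MvPolynomial (Fin n) ℂ, g.IsSymmetric ∧ tensorCoord c n m 0 = vand n * g := by
  refine MvPolynomial.exists_isSymmetric_of_antisymmetric fun σ => ?_
  have h := tensorCoord_permAct c σ m 0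
  rw [hm σ, map_smul, Pi.smul_apply, sign_smul] at h
  exact h.symm

theorem mem_wedge_of_mem_highest {m : TPow n M} (hm : m ∈ highest c n)
    (h : tensorCoord c n m 0 = vand n) : m ∈ wedge n M := by
  intro σ
  have hσ : permAct n σ m ∈ highest c n := by
    intro s hs
    rw [tensorCoord_permAct, hm, map_zero]
    intro h0
    refine hs (funext fun i => ?_)
    simpa using congrFun h0 (σ.symm i)
  refine hc.ext_of_mem_highest hσ ((highest c n).smul_mem _ hm) ?_
  rw [tensorCoord_permAct, map_smul, Pi.smul_apply, sign_smul]
  change MvPolynomial.rename σ (tensorCoord c n m 0) = _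
  rw [h, MvPolynomial.rename_vand]

theorem wedge_inf_weightSpace {w : TPow n M} (hw : w ∈ highest c n)
    (hv : tensorCoord c n w 0 = vand n) :
    (wedge n M).toSubmodule ⊓ weightSpace (TPow n M) (n : ℤ) =
      (LieSubmodule.lieSpan ℂ currentCartan {w}).toSubmodule := by
  apply le_antisymm
  · rintro m ⟨hm, hm'⟩
    rw [SetLike.mem_coe, hc.mem_weightSpace_iff] at hm'
    obtain ⟨g, hg, hgm⟩ := exists_eq_vand_mul (c := c) hm
    obtain ⟨m', hm'N, hm'h, hm'g⟩ := hc.exists_mul_isSymmetric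
      (N := (LieSubmodule.lieSpan ℂ currentCartan {w}).toSubmodule)
      (fun p u hu => (LieSubmodule.lieSpan ℂ currentCartan {w}).lie_mem
        (x := (⟨p ⊗ₜ[ℂ] slh, p, rfl⟩ : currentCartan)) hu)
      (LieSubmodule.subset_lieSpan rfl) hw hg
    rwa [hc.ext_of_mem_highest hm' hm'h (by rw [hgm, hm'g, hv, mul_comm])]
  -- The right side of the reverse inclusion is itself `h ⊗ ℂ[t]`-stable and contains `w`.
  · let P : LieSubmodule ℂ currentCartan (TPow n M) :=
      { toSubmodule := (wedge n M).toSubmodule ⊓ highest c n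
        lie_mem := by
          rintro ⟨_, p, rfl⟩ m ⟨hm, hm'⟩
          exact ⟨(wedge n M).lie_mem hm, hc.h_lie_mem_highest hm' p⟩ }
    have h : LieSubmodule.lieSpan ℂ currentCartan {w} ≤ P := by
      rw [LieSubmodule.lieSpan_le, Set.singleton_subset_iff]
      exact ⟨hc.mem_wedge_of_mem_highest hw hv, hw⟩
    exact fun m hm => ⟨(h hm).1, hc.mem_weightSpace_iff.2 (h hm).2⟩

omit hc in
-- Transports submodules of the sign component to stable subspaces of the full tensor power, where
-- the preceding results apply.
theorem lie_mem_map_wedge (N : LieSubmodule ℂ Current (wedge n M)) (a : Current) (m : TPow n M)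
    (hm : m ∈ N.toSubmodule.map (wedge n M).toSubmodule.subtype) :
    ⁅a, m⁆ ∈ N.toSubmodule.map (wedge n M).toSubmodule.subtype := by
  obtain ⟨m, hm, rfl⟩ := hm
  exact ⟨(⁅a, (show wedge n M from m)⁆ : wedge n M), N.lie_mem hm, rfl⟩

theorem exists_mem_highest_wedge {N : LieSubmodule ℂ Current (wedge n M)} (hN : N ≠ ⊥) :
    ∃ m ∈ N, m ≠ 0 ∧ (m : TPow n M) ∈ highest c n := by
  obtain ⟨_, ⟨m, hmN, rfl⟩, hm0, hm⟩ := hc.exists_mem_highest (lie_mem_map_wedge N) (by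
    rw [Ne, (Submodule.map_injective_of_injective
      (Submodule.subtype_injective _)).eq_iff' (Submodule.map_bot _)]
    simpa using hN)
  exact ⟨m, hmN, fun h => hm0 (congrArg Subtype.val h), hm⟩

theorem exists_mul_isSymmetric_wedge {N : LieSubmodule ℂ Current (wedge n M)} {m : wedge n M}
    (hmN : m ∈ N) (hm : (m : TPow n M) ∈ highest c n) {g : MvPolynomial (Fin n) ℂ}
    (hg : g.IsSymmetric) : ∃ m' ∈ N, (m' : TPow n M) ∈ highest c n ∧
      tensorCoord c n (m' : TPow n M) 0 = g * tensorCoord c n (m : TPow n M) 0 := by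
  obtain ⟨_, ⟨m', hm'N, rfl⟩, h⟩ := hc.exists_mul_isSymmetric
    (fun p => lie_mem_map_wedge N (p ⊗ₜ[ℂ] slh)) ⟨m, hmN, rfl⟩ hm hg
  exact ⟨m', hm'N, h⟩

theorem inf_weightSpace_wedge_ne_bot {N : LieSubmodule ℂ Current (wedge n M)} (hN : N ≠ ⊥) :
    N.toSubmodule ⊓ weightSpace (wedge n M) (n : ℤ) ≠ ⊥ := by
  obtain ⟨m, hmN, hm0, hm⟩ := hc.exists_mem_highest_wedge hN
  refine (Submodule.ne_bot_iff _).2 ⟨m, ⟨hmN, ?_⟩, hm0⟩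
  rw [← hc.mem_weightSpace_iff] at hm
  rw [SetLike.mem_coe, weightSpace, Module.End.mem_eigenspace_iff] at *
  exact Subtype.ext hm

theorem indecomposable_wedge {w : TPow n M} (hw : w ∈ highest c n)
    (hv : tensorCoord c n w 0 = vand n) : Indecomposable (wedge n M) := by
  refine ⟨⟨⟨w, hc.mem_wedge_of_mem_highest hw hv⟩, 0, fun h => ?_⟩, fun U V hUV => ?_⟩
  · have h0 : w = 0 := congrArg Subtype.val h
    rw [h0, map_zero] at hv
    exact MvPolynomial.vand_ne_zero n hv.symm
  · by_contra! hne
    obtain ⟨u, huU, hu0, hu⟩ := hc.exists_mem_highest_wedge hne.1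
    obtain ⟨v, hvV, hv0, hv⟩ := hc.exists_mem_highest_wedge hne.2
    obtain ⟨f, hf, huf⟩ := exists_eq_vand_mul (c := c) u.2
    obtain ⟨g, hg, hvg⟩ := exists_eq_vand_mul (c := c) v.2
    -- Cross-multiplication: `g · u` and `f · v` have the same component `Vand · f · g`, so they
    -- coincide and lie in `U ∩ V`.
    obtain ⟨u', hu'U, hu'h, hu'⟩ := hc.exists_mul_isSymmetric_wedge huU hu hg
    obtain ⟨v', hv'V, hv'h, hv'⟩ := hc.exists_mul_isSymmetric_wedge hvV hv hf
    have huv : u' = v' := Subtype.ext (hc.ext_of_mem_highest hu'h hv'h (by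
      rw [hu', hv', huf, hvg]; ring))
    have hu'0 : u' = 0 := (Submodule.disjoint_def.1 hUV.disjoint) u' hu'U (huv ▸ hv'V)
    have hne0 (z : wedge n M) (hz : (z : TPow n M) ∈ highest c n) (hz0 : z ≠ 0) :
        tensorCoord c n (z : TPow n M) 0 ≠ 0 := fun h => hz0 (Subtype.ext
      (hc.ext_of_mem_highest hz (zero_mem _) (h.trans (congrFun (map_zero (tensorCoord c n)) 0).symm)))
    rw [hu'0, show ((0 : wedge n M) : TPow n M) = 0 from rfl, map_zero, Pi.zero_apply] at hu'
    refine mul_ne_zero (fun hg0 => hne0 v hv hv0 ?_) (hne0 u hu hu0) hu'.symm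
    rw [hvg, hg0, mul_zero]

end NatCoordinates

end Action

/-! ### Coordinates on `W(1)` and the Vandermonde vector -/

theorem weylEquiv_lie (a : Current) (m : Weyl 1) : weylEquiv ⁅a, m⁆ = ⁅a, weylEquiv m⁆ :=
  weylLift_lie isWeylVector_e1 a m

theorem coord_e1 (j : Fin 2) (p : ℂ[X]) : coord j (p ⊗ₜ[ℂ] e1) = if j = 0 then p else 0 := by
  rw [coord_tmul]
  fin_cases j <;> simp [e1]

theorem coord_e2 (j : Fin 2) (p : ℂ[X]) : coord j (p ⊗ₜ[ℂ] e2) = if j = 1 then p else 0 := by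
  rw [coord_tmul]
  fin_cases j <;> simp [e2]

theorem coord_lie_x (p : ℂ[X]) (m : NatRepT) :
    coord 0 ⁅p ⊗ₜ[ℂ] slx, m⁆ = p * coord 1 m ∧ coord 1 ⁅p ⊗ₜ[ℂ] slx, m⁆ = 0 := by
  have h : ⁅p ⊗ₜ[ℂ] slx, m⁆ = (p * coord 1 m) ⊗ₜ[ℂ] e1 := by
    nth_rw 1 [natRepT_eq m]
    rw [natRepT_lie_add, lie_tmul, lie_tmul, slx_e1, slx_e2, TensorProduct.tmul_zero, zero_add]
  rw [h, coord_e1, coord_e1]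
  simp

theorem coord_lie_h (p : ℂ[X]) (m : NatRepT) :
    coord 0 ⁅p ⊗ₜ[ℂ] slh, m⁆ = p * coord 0 m ∧
      coord 1 ⁅p ⊗ₜ[ℂ] slh, m⁆ = -(p * coord 1 m) := by
  have h : ⁅p ⊗ₜ[ℂ] slh, m⁆ = (p * coord 0 m) ⊗ₜ[ℂ] e1 - (p * coord 1 m) ⊗ₜ[ℂ] e2 := by
    nth_rw 1 [natRepT_eq m]
    rw [natRepT_lie_add, lie_tmul, lie_tmul, slh_e1, slh_e2, TensorProduct.tmul_neg,
      sub_eq_add_neg]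
  rw [h, map_sub, map_sub, coord_e1, coord_e1, coord_e2, coord_e2]
  simp

theorem natCoordinates_weyl :
    NatCoordinates fun j => coord j ∘ₗ (weylEquiv : Weyl 1 →ₗ[ℂ] NatRepT) where
  bijective := by
    have h : Function.Bijective (LinearMap.pi coord) := by
      constructor
      · refine (injective_iff_map_eq_zero _).2 fun m hm => ?_
        rw [natRepT_eq m, show coord 0 m = 0 from congrFun hm 0,
          show coord 1 m = 0 from congrFun hm 1]
        simp
      · intro f
        refine ⟨f 0 ⊗ₜ[ℂ] e1 + f 1 ⊗ₜ[ℂ] e2, funext fun j => ?_⟩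
        rw [LinearMap.pi_apply, map_add, coord_e1, coord_e2]
        fin_cases j <;> simp
    exact h.comp weylEquiv.toLinearEquiv.bijective
  x_zero p m := by
    change coord 0 (weylEquiv ⁅_, _⁆) = p * coord 1 (weylEquiv m)
    rw [weylEquiv_lie, (coord_lie_x p _).1]
  x_one p m := by
    change coord 1 (weylEquiv ⁅_, _⁆) = 0
    rw [weylEquiv_lie, (coord_lie_x p _).2]
  h_zero p m := by
    change coord 0 (weylEquiv ⁅_, _⁆) = p * coord 0 (weylEquiv m)
    rw [weylEquiv_lie, (coord_lie_h p _).1]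
  h_one p m := by
    change coord 1 (weylEquiv ⁅_, _⁆) = -(p * coord 1 (weylEquiv m))
    rw [weylEquiv_lie, (coord_lie_h p _).2]

/-- The element `e₁^{⊗ n} ⊗ f` of `W(1)^{⊗ n}` has the single component `f`. -/
theorem tensorCoord_e1Tensor (n : ℕ) (f : MvPolynomial (Fin n) ℂ) :
    tensorCoord (fun j => coord j ∘ₗ (weylEquiv : Weyl 1 →ₗ[ℂ] NatRepT)) n
      (PiTensorProduct.map (fun _ => (weylEquiv.symm : NatRepT →ₗ[ℂ] Weyl 1)) (e1Tensor n f)) =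
      Pi.single 0 f := by
  have h : tensorCoord (fun j => coord j ∘ₗ (weylEquiv : Weyl 1 →ₗ[ℂ] NatRepT)) n ∘ₗ
      PiTensorProduct.map (fun _ => (weylEquiv.symm : NatRepT →ₗ[ℂ] Weyl 1)) ∘ₗ e1Tensor n =
      LinearMap.single ℂ (fun _ : Fin n → Fin 2 => MvPolynomial (Fin n) ℂ) 0 := by
    refine (MvPolynomial.basisMonomials (Fin n) ℂ).ext fun m => funext fun s => ?_
    rw [LinearMap.comp_apply, LinearMap.comp_apply, e1Tensor, Module.Basis.constr_basis,
      PiTensorProduct.map_tprod, tensorCoord_tprod, MvPolynomial.coe_basisMonomials]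
    have hcoord (i : Fin n) : (coord (s i) ∘ₗ (weylEquiv : Weyl 1 →ₗ[ℂ] NatRepT))
        ((weylEquiv.symm : NatRepT →ₗ[ℂ] Weyl 1) ((Polynomial.X ^ m i : ℂ[X]) ⊗ₜ[ℂ] e1)) =
        if s i = 0 then Polynomial.X ^ m i else 0 := by
      change coord (s i) (weylEquiv (weylEquiv.symm _)) = _
      rw [LieModuleEquiv.apply_symm_apply, coord_e1]
    simp only [hcoord]
    by_cases hs : s = 0
    · subst hs
      rw [LinearMap.single_apply, Pi.single_eq_same, MvPolynomial.monomial_eq,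
        Finsupp.prod_fintype _ _ (by simp)]
      simp [atVar]
    · obtain ⟨i, hi⟩ := Function.ne_iff.1 hs
      rw [LinearMap.single_apply, Pi.single_eq_of_ne hs]
      refine Finset.prod_eq_zero (Finset.mem_univ i) ?_
      rw [if_neg (show s i ≠ 0 from hi), map_zero]
  exact DFunLike.congr_fun h f

theorem e1Tensor_mem_highest (n : ℕ) (f : MvPolynomial (Fin n) ℂ) :
    PiTensorProduct.map (fun _ => (weylEquiv.symm : NatRepT →ₗ[ℂ] Weyl 1)) (e1Tensor n f) ∈
      highest (fun j => coord j ∘ₗ (weylEquiv : Weyl 1 →ₗ[ℂ] NatRepT)) n := fun s hs => by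
  rw [tensorCoord_e1Tensor, Pi.single_eq_of_ne hs]

end CurrentSl2
end

open CurrentSl2
theorem proposition4p2 (l : ℕ) :
    -- nonzero graded submodules of the exterior power have nonzero `l`-weight space
    (∀ M : LieSubmodule ℂ Current (wedge l (Weyl 1)),
      IsGradedSub (wedgeGrade l (weylGrade 1)) M → M ≠ ⊥ →
        M.toSubmodule ⊓ weightSpace (wedge l (Weyl 1)) (l : ℤ) ≠ ⊥) ∧
    -- under the identification `φ` of `W(1)` with `V(1) ⊗ ℂ[t]`, the `l`-weight space is the
    -- `h ⊗ ℂ[t]`-submodule generated by `e₁^{⊗ l} ⊗ Vand(l)`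
    (∃ φ : Weyl 1 ≃ₗ⁅ℂ, Current⁆ NatRepT,
      φ (weylGen 1) = (1 : Polynomial ℂ) ⊗ₜ[ℂ] e1 ∧
      (wedge l (Weyl 1)).toSubmodule ⊓ weightSpace (TPow l (Weyl 1)) (l : ℤ) =
        (LieSubmodule.lieSpan ℂ currentCartan
          {PiTensorProduct.map (fun _ => (φ.symm : NatRepT →ₗ[ℂ] Weyl 1))
            (e1Tensor l (vand l))}).toSubmodule) ∧
    -- the exterior power is indecomposable
    Indecomposable (wedge l (Weyl 1)) := by
  have hw := e1Tensor_mem_highest l (vand l)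
  have hv := congrFun (tensorCoord_e1Tensor l (vand l)) 0
  rw [Pi.single_eq_same] at hv
  exact ⟨fun M _ hM => natCoordinates_weyl.inf_weightSpace_wedge_ne_bot hM,
    ⟨weylEquiv, weylEquiv_weylGen, natCoordinates_weyl.wedge_inf_weightSpace hw hv⟩,
    natCoordinates_weyl.indecomposable_wedge hw hv⟩
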